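/- Let $d\in\mathbb N$. A mask is a finitely supported sequence $a:\mathbb Z^d\to\mathbb R$; its symbol is $a(z)=\sum_{\alpha\in\mathbb Z^d}a(\alpha)z^\alpha$ for $z\in(\mathbb C\setminus\{0\})^d$, where $z^\alpha=z_1^{\alpha_1}\cdots z_d^{\alpha_d}$, and its subdivision operator $S_a$ on $\ell_\infty(\mathbb Z^d)$ is $(S_af)(\alpha)=\sum_{\beta\in\mathbb Z^d}a(\alpha-2\beta)f(\beta)$. For $s\in\mathbb N_0$, the stationary scheme $S_a$ is said to converge to $C^s(\mathbb R^d)$ limit functions if for every $f\in\ell_\infty(\mathbb Z^d)$ there is $g\in C^s(\mathbb R^d)$ with $$\lim_{k\to\infty}\ \sup_{\alpha\in\mathbb Z^d}\bigl|g(2^{-(k+1)}\alpha)-(S_a^{k+1}f)(\alpha)\bigr|=0,$$ and $g$ is not identically zero for at least one nonzero $f$. It is called convergent if this holds with $s=0$. For $v\in\mathbb N_0^d$ put $s_v(z)=\frac{1+z^v}{2}$; for a finite collection $D$ of vectors of $\mathbb N_0^d$, repetitions allowed, put $s_D(z)=\prod_{v\in D}s_v(z)$; and for a basis $V=\{v^{[1]},\dots,v^{[d]}\}$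 of $\mathbb R^d$ with all $v^{[j]}\in\mathbb N_0^d$ put $s_V(z)=\prod_{j=1}^d s_{v^{[j]}}(z)$. Let $\mathscr C_0$ be the set of masks whose symbol is of the form $a(z)s_D(z)$, where $a$ is a mask with nonnegative entries such that $S_a$ is convergent and $D$ is a finite collection as above. Given a sequence $\mathcal V=\{V_j\}_{j\ge1}$ of bases of $\mathbb R^d$ consisting of vectors of $\mathbb N_0^d$, put $\mathscr C_0^{\mathcal V}=\mathscr C_0$ and, for $j\ge1$, let $\mathscr C_j^{\mathcal V}$ be the set of masks whose symbol is the product of the symbol of a mask in $\mathscr C_{j-1}^{\mathcal V}$ and $s_{V_j}(z)$. **Proposition.** Let $\mathcal V=\{V_j\}_{j\ge1}$ be a sequence of bases of $\mathbb R^d$ consisting of vectors of $\mathbb N_0^d$, let $m\ge1$ and let $c\in\mathscr C_m^{\mathcal V}$. Then the stationary scheme $S_c$ converges to $C^{m-1}(\mathbb R^d)$ limit functions. -/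

import Mathlib

open Filter Topology
open scoped ENNReal

noncomputable section

namespace Subdivision

/-- A finitely supported real mask on the lattice `ℤ^d`. -/
abbrev Mask (d : ℕ) : Type := (Fin d → ℤ) →₀ ℝ

/-- The subdivision operator `(S_a f)(α) = ∑_β a(α - 2β) f(β)`. For each `α` only finitely many
terms are nonzero, because `a` has finite support. -/
def subdiv {d : ℕ} (a : Mask d) (f : (Fin d → ℤ) → ℝ) : (Fin d → ℤ) → ℝ :=
  fun α => ∑ᶠ β : Fin d → ℤ, a (α - 2 • β) * f β

/-- The refined data `f^[r] = S_{a_{r-1}} ⋯ S_{a_0} f` (and `f^[0] = f`). -/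
def refinedData {d : ℕ} (a : ℕ → Mask d) (f : (Fin d → ℤ) → ℝ) : ℕ → (Fin d → ℤ) → ℝ
  | 0 => f
  | r + 1 => subdiv (a r) (refinedData a f r)

/-- `g` is the limit of the scheme `(S_{a_k})` on the initial data `f`:
`‖g(2^{-(k+1)} ·) - S_{a_k} ⋯ S_{a_0} f‖_∞ → 0`, the sup norm being over `ℤ^d`. -/
def IsLimit {d : ℕ} (a : ℕ → Mask d) (f : (Fin d → ℤ) → ℝ) (g : (Fin d → ℝ) → ℝ) : Prop :=
  TendstoUniformly
    (fun (k : ℕ) (α : Fin d → ℤ) =>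
      g (fun i => (α i : ℝ) / 2 ^ (k + 1)) - refinedData a f (k + 1) α)
    (fun _ => 0) atTop

/-- The scheme `(S_{a_k})` converges to `C^s(ℝ^d)` limit functions: every bounded initial sequence
has a `C^s` limit, and the limit is nonzero for at least one nonzero bounded initial sequence. -/
def ConvergesTo {d : ℕ} (s : ℕ) (a : ℕ → Mask d) : Prop :=
  (∀ f : (Fin d → ℤ) → ℝ, Memℓp f ∞ → ∃ g : (Fin d → ℝ) → ℝ, ContDiff ℝ s g ∧ IsLimit a f g) ∧
  (∃ f : (Fin d → ℤ) → ℝ, Memℓp f ∞ ∧ f ≠ 0 ∧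
    ∃ g : (Fin d → ℝ) → ℝ, ContDiff ℝ s g ∧ IsLimit a f g ∧ g ≠ 0)

/-- The stationary scheme `S_a` converges to `C^s(ℝ^d)` limit functions. -/
def StationaryConvergesTo {d : ℕ} (s : ℕ) (a : Mask d) : Prop :=
  ConvergesTo s (fun _ => a)

/-- The symbol `a(z) = ∑_α a(α) z^α`, for `z ∈ (ℂ ∖ {0})^d`. -/
def symbol {d : ℕ} (a : Mask d) (z : Fin d → ℂˣ) : ℂ :=
  a.sum fun α t => (t : ℂ) * ∏ i, (z i : ℂ) ^ (α i)

/-- The symbol `(1 + z^v) / 2` of the directional smoothing factor in direction `v ∈ ℕ_0^d`. -/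
def dirFactor {d : ℕ} (v : Fin d → ℕ) (z : Fin d → ℂˣ) : ℂ :=
  (1 + ∏ i, (z i : ℂ) ^ (v i)) / 2

/-- `s_D(z) = ∏_{v ∈ D} (1 + z^v) / 2`, for a finite collection `D` of directions with possible
repetitions. -/
def collectionFactor {d : ℕ} (D : Multiset (Fin d → ℕ)) (z : Fin d → ℂˣ) : ℂ :=
  (D.map fun v => dirFactor v z).prod

/-- The symbol `s_V(z) = ∏_{j=1}^d (1 + z^{v^[j]}) / 2` of the full smoothing factor given by
`V = {v^[1], …, v^[d]}`. -/
def fullFactor {d : ℕ} (V : Fin d → Fin d → ℕ) (z : Fin d → ℂˣ) : ℂ :=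
  ∏ j, dirFactor (V j) z

/-- `V = {v^[1], …, v^[d]} ⊂ ℕ_0^d` is a basis of `ℝ^d`, that is, its `d` vectors are linearly
independent over `ℝ`. -/
def IsNatBasis {d : ℕ} (V : Fin d → Fin d → ℕ) : Prop :=
  LinearIndependent ℝ fun (j : Fin d) (i : Fin d) => (V j i : ℝ)

/-- The set `𝒞_0`: masks whose symbol is the product of the symbol of a nonnegative mask `a` with
`S_a` convergent and of `s_D(z)` for some finite collection `D` of directions in `ℕ_0^d`.
(The zero vector in `D` would contribute the factor `1`, so excluding it gives the same set.) -/
def classZero (d : ℕ) : Set (Mask d) :=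
  {c | ∃ (a : Mask d) (D : Multiset (Fin d → ℕ)),
    (∀ α, 0 ≤ a α) ∧ StationaryConvergesTo 0 a ∧
    ∀ z, symbol c z = symbol a z * collectionFactor D z}

/-- The sets `𝒞_j^𝒱` for `𝒱 = (V_j)_{j ≥ 1}`; the entry of `𝒱` at index `0` is not used. -/
def classC {d : ℕ} (𝒱 : ℕ → Fin d → Fin d → ℕ) : ℕ → Set (Mask d)
  | 0 => classZero d
  | j + 1 => {c | ∃ c' ∈ classC 𝒱 j, ∀ z, symbol c z = symbol c' z * fullFactor (𝒱 (j + 1)) z}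

end Subdivision

end

/-!
A factor `(1 + z^v) / 2` in the symbol averages the refined data: since
`∏_{j < k} (1 + z^{2^j v}) = ∑_{l < 2^k} z^{l v}`, the data of level `k` become the means of
`2^k` consecutive old data in direction `v` (`subdivLin_pow_smoothMask`). These means are Riemann
sums at spacing `2^{-k} v`, so if the old scheme has the uniformly continuous limit `g`, then the
new one has the limit `x ↦ ∫₀¹ g (x - t v) dt` (`IsLimit.smoothMask`). Averaging preserves `C^s`, and
it creates the derivative `g(x) - g(x - v)` in direction `v`. Averaging in all directions of a basis
thus gives `C^s` derivatives in all these directions, hence a `C^{s+1}` function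
(`contDiff_succ_listAverage`). Every full smoothing factor gains one order in this way.

Two facts about a convergent scheme start the induction (`HasUniformLimits`). Its limits can be
taken uniformly continuous: the limit of the unit impulse has compact support, and bounded data have
as limit a superposition of its lattice translates (`exists_uniformContinuous_isLimit`). And it
reproduces constants (`subdivLin_one_of_convergent`), a property that survives smoothing and
supplies the nonzero limit function `1`. Finally, products of symbols determine products of masks, because
distinct characters of the torus are linearly independent (`symbol_injective`).

The argument gives `C^m` limit functions, one order more than is claimed.
-/

namespace Subdivision

/-! ### Averages over segments and smoothness -/

section Averages

variable {E : Type*} [NormedAddCommGroup E] [NormedSpace ℝ E]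

/-- The average `x ↦ ∫₀¹ g (x - t v) dt` of `g` over segments in direction `v`, that is, the
convolution of `g` with the uniform distribution on the segment `[0, v]`. -/
noncomputable def dirAverage (v : E) (g : E → ℝ) (x : E) : ℝ :=
  ∫ t in (0 : ℝ)..1, g (x - t • v)

theorem continuous_dirAverage {g : E → ℝ} (hg : Continuous g) (v : E) :
    Continuous (dirAverage v g) := by
  unfold dirAverage
  apply intervalIntegral.continuous_parametric_intervalIntegral_of_continuous'
  fun_prop

theorem uniformContinuous_dirAverage {g : E → ℝ} (hg : UniformContinuous g) (v : E) :
    UniformContinuous (dirAverage v g) := by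
  rw [Metric.uniformContinuous_iff] at hg ⊢
  intro ε hε
  obtain ⟨δ, hδ, h⟩ := hg (ε / 2) (half_pos hε)
  have hc : Continuous g := (Metric.uniformContinuous_iff.2 hg).continuous
  refine ⟨δ, hδ, fun {x y} hxy => ?_⟩
  rw [dist_eq_norm, dirAverage, dirAverage, ← intervalIntegral.integral_sub
    (Continuous.intervalIntegrable (by fun_prop) _ _)
    (Continuous.intervalIntegrable (by fun_prop) _ _)]
  refine (intervalIntegral.norm_integral_le_of_norm_le_const (C := ε / 2) fun t _ => ?_).trans_lt ?_
  · rw [← dist_eq_norm]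
    exact (h (by simpa using hxy)).le
  · simpa using hε

/-- Riemann sums of a uniformly continuous function along the segments `x - [0, v]` converge to
the averages over these segments, uniformly in `x`. -/
theorem exists_forall_abs_dirAverage_sub_le {g : E → ℝ} (hg : UniformContinuous g) (v : E)
    {ε : ℝ} (hε : 0 < ε) :
    ∃ N : ℕ, ∀ n, N ≤ n → 0 < n → ∀ x,
      |dirAverage v g x - (∑ l ∈ Finset.range n, g (x - ((l : ℝ) / n) • v)) / n| ≤ ε := by
  have hc := hg.continuous
  rw [Metric.uniformContinuous_iff] at hg
  obtain ⟨δ, hδ, h⟩ := hg ε hε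
  obtain ⟨N, hN⟩ := exists_nat_gt (‖v‖ / δ)
  refine ⟨N, fun n hn hn0 x => ?_⟩
  have hn0' : (0 : ℝ) < n := by exact_mod_cast hn0
  have hvn : ‖v‖ < δ * n := by
    rw [div_lt_iff₀ hδ] at hN
    have : (N : ℝ) ≤ n := by exact_mod_cast hn
    nlinarith
  have hF : Continuous fun t : ℝ => g (x - t • v) := by fun_prop
  have hsplit : dirAverage v g x
      = ∑ l ∈ Finset.range n, ∫ t in ((l : ℝ) / n)..(((l + 1 : ℕ) : ℝ) / n), g (x - t • v) := by
    rw [intervalIntegral.sum_integral_adjacent_intervals (a := fun l : ℕ => (l : ℝ) / n)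
      (fun k _ => hF.intervalIntegrable _ _)]
    simp [dirAverage, hn0'.ne']
  rw [hsplit, Finset.sum_div, ← Finset.sum_sub_distrib]
  have hterm : ∀ l ∈ Finset.range n,
      |(∫ t in ((l : ℝ) / n)..(((l + 1 : ℕ) : ℝ) / n), g (x - t • v))
        - g (x - ((l : ℝ) / n) • v) / n| ≤ ε / n := by
    intro l _
    have hlen : ((l + 1 : ℕ) : ℝ) / n - (l : ℝ) / n = 1 / n := by push_cast; ring
    have hconst : g (x - ((l : ℝ) / n) • v) / n
        = ∫ _ in ((l : ℝ) / n)..(((l + 1 : ℕ) : ℝ) / n), g (x - ((l : ℝ) / n) • v) := by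
      rw [intervalIntegral.integral_const, hlen, smul_eq_mul]; ring
    rw [hconst, ← intervalIntegral.integral_sub (hF.intervalIntegrable _ _)
      (intervalIntegrable_const), ← Real.norm_eq_abs]
    refine (intervalIntegral.norm_integral_le_of_norm_le_const (C := ε) fun t ht => ?_).trans ?_
    · rw [← dist_eq_norm]
      refine (h ?_).le
      have hle : (l : ℝ) / n ≤ ((l + 1 : ℕ) : ℝ) / n := by
        have : (0 : ℝ) < 1 / n := by positivity
        linarith
      rw [Set.uIoc_of_le hle] at ht
      have ht1 : |t - (l : ℝ) / n| ≤ 1 / n := by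
        rw [abs_of_nonneg (by linarith [ht.1])]; linarith [ht.2]
      rw [dist_sub_left, dist_eq_norm, ← sub_smul, norm_smul, Real.norm_eq_abs]
      calc |t - (l : ℝ) / n| * ‖v‖ ≤ 1 / n * ‖v‖ := by gcongr
        _ < δ := by rw [one_div, inv_mul_lt_iff₀ hn0']; linarith
    · rw [hlen, abs_of_pos (by positivity)]; exact (mul_one_div _ _).le
  calc _ ≤ ∑ l ∈ Finset.range n, ε / n :=
        (Finset.abs_sum_le_sum_abs _ _).trans (Finset.sum_le_sum hterm)
    _ = ε := by simp; field_simp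

/-- A directional derivative that exists everywhere is a derivative along each line. -/
theorem hasDerivAt_line {g g' : E → ℝ} {v : E}
    (h : ∀ x, HasDerivAt (fun t : ℝ => g (x + t • v)) (g' x) 0) (x : E) (t : ℝ) :
    HasDerivAt (fun t : ℝ => g (x + t • v)) (g' (x + t • v)) t := by
  have h1 := HasDerivAt.comp_sub_const (f := fun u : ℝ => g (x + t • v + u • v)) t t
    (f' := g' (x + t • v)) (by simpa using h (x + t • v))
  simpa [sub_smul] using h1

/-- Averaging in direction `w` commutes with differentiation in direction `v`. -/
theorem hasDerivAt_dirAverage {g g' : E → ℝ} (hg : Continuous g) (hg' : Continuous g') {v : E}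
    (h : ∀ x, HasDerivAt (fun t : ℝ => g (x + t • v)) (g' x) 0) (w x : E) :
    HasDerivAt (fun t : ℝ => dirAverage w g (x + t • v)) (dirAverage w g' x) 0 := by
  -- A bound for the derivative of the integrand, for parameters in `[-1, 1]`, by compactness.
  have hK : IsCompact ((Set.Icc (-1 : ℝ) 1) ×ˢ (Set.Icc (0 : ℝ) 1)) :=
    isCompact_Icc.prod isCompact_Icc
  obtain ⟨C, hC⟩ := hK.exists_bound_of_continuousOn
    (f := fun p : ℝ × ℝ => g' (x + p.1 • v - p.2 • w)) (Continuous.continuousOn (by fun_prop))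
  have key := intervalIntegral.hasDerivAt_integral_of_dominated_loc_of_deriv_le
    (μ := MeasureTheory.volume) (a := (0 : ℝ)) (b := 1) (𝕜 := ℝ)
    (F := fun u t => g (x + u • v - t • w)) (F' := fun u t => g' (x + u • v - t • w))
    (x₀ := (0 : ℝ)) (s := Metric.ball (0 : ℝ) 1) (bound := fun _ => C)
    (Metric.ball_mem_nhds _ one_pos)
    (Eventually.of_forall fun u => Continuous.aestronglyMeasurable (by fun_prop))
    (Continuous.intervalIntegrable (by fun_prop) _ _)
    (Continuous.aestronglyMeasurable (by fun_prop))
    (Eventually.of_forall fun t ht u hu => by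
      rw [Set.uIoc_of_le zero_le_one] at ht
      rw [Metric.mem_ball, dist_zero_right, Real.norm_eq_abs, abs_lt] at hu
      exact hC (u, t) ⟨⟨hu.1.le, hu.2.le⟩, ⟨ht.1.le, ht.2⟩⟩)
    intervalIntegrable_const
    (Eventually.of_forall fun t _ u _ => by
      have := hasDerivAt_line h (x - t • w) u
      simpa only [sub_add_eq_add_sub] using this)
  simpa [dirAverage] using key.2

/-- Averaging in direction `v` produces a derivative in direction `v`, a backward difference. -/
theorem hasDerivAt_dirAverage_self {g : E → ℝ} (hg : Continuous g) (v x : E) :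
    HasDerivAt (fun t : ℝ => dirAverage v g (x + t • v)) (g x - g (x - v)) 0 := by
  have hF : Continuous fun s : ℝ => g (x + s • v) := by fun_prop
  have hint : ∀ t : ℝ, dirAverage v g (x + t • v)
      = (∫ s in (0 : ℝ)..t, g (x + s • v)) - ∫ s in (0 : ℝ)..(t - 1), g (x + s • v) := by
    intro t
    rw [intervalIntegral.integral_interval_sub_left (hF.intervalIntegrable _ _)
      (hF.intervalIntegrable _ _)]
    have := intervalIntegral.integral_comp_sub_left (a := 0) (b := 1)
      (fun s : ℝ => g (x + s • v)) t
    rw [sub_zero] at this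
    rw [← this, dirAverage]
    congr 1; ext s; congr 1; rw [sub_smul]; abel
  simp_rw [hint]
  have h1 : HasDerivAt (fun t : ℝ => ∫ s in (0 : ℝ)..t, g (x + s • v)) (g x) 0 := by
    simpa using (hF.integral_hasStrictDerivAt 0 0).hasDerivAt
  have h2 : HasDerivAt (fun t : ℝ => ∫ s in (0 : ℝ)..t, g (x + s • v)) (g (x - v)) (0 - 1) := by
    simpa [sub_eq_add_neg] using (hF.integral_hasStrictDerivAt 0 (-1)).hasDerivAt
  exact h1.sub (h2.comp_sub_const 0 1)

/-- A function with continuous derivatives in the directions of a basis is differentiable. -/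
theorem hasFDerivAt_of_hasDerivAt_basis [FiniteDimensional ℝ E] {ι : Type*} [Fintype ι]
    (b : Module.Basis ι ℝ E) {g : E → ℝ} {g' : ι → E → ℝ} (hg' : ∀ i, Continuous (g' i))
    (h : ∀ i x, HasDerivAt (fun t : ℝ => g (x + t • b i)) (g' i x) 0) (x : E) :
    HasFDerivAt g (∑ i, g' i x • (b.coord i).toContinuousLinearMap) x := by
  classical
  let c : ι → E →L[ℝ] ℝ := fun i => (b.coord i).toContinuousLinearMap
  -- The basis directions are used up one after the other along a path from `x` to `x + y`.
  have main : ∀ J : Finset ι, (fun y : E => g (x + ∑ i ∈ J, c i y • b i) - g x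
      - ∑ i ∈ J, c i y * g' i x) =o[𝓝 0] fun y => y := by
    intro J
    induction J using Finset.induction_on with
    | empty => simp
    | insert i J hi ih =>
      have step : (fun y : E => g (x + ∑ j ∈ J, c j y • b j + c i y • b i)
          - g (x + ∑ j ∈ J, c j y • b j) - c i y * g' i x) =o[𝓝 0] fun y => y := by
        refine Asymptotics.IsLittleO.trans_isBigO (g := fun y => c i y) ?_
          ((c i).isBigO_id _)
        rw [Asymptotics.isLittleO_iff]
        intro ε hε
        have hcont : Continuous fun p : E × ℝ =>
            g' i (x + ∑ j ∈ J, c j p.1 • b j + p.2 • b i) := by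
          have := hg' i
          fun_prop
        have hnear : ∀ᶠ p : E × ℝ in 𝓝 (0, 0),
            |g' i (x + ∑ j ∈ J, c j p.1 • b j + p.2 • b i) - g' i x| < ε := by
          have := hcont.tendsto (0, 0)
          simp only [map_zero, zero_smul, Finset.sum_const_zero, add_zero] at this
          exact (Metric.tendsto_nhds.1 this ε hε).mono fun p hp => by
            simpa [Real.dist_eq] using hp
        rw [nhds_prod_eq] at hnear
        obtain ⟨P, hP, Q, hQ, hPQ⟩ := eventually_prod_iff.1 hnear
        obtain ⟨δ, hδ, hQ⟩ := Metric.eventually_nhds_iff.1 hQ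
        have hci : ∀ᶠ y in 𝓝 (0 : E), |c i y| < δ := by
          have := (c i).continuous.tendsto 0
          rw [map_zero] at this
          exact (Metric.tendsto_nhds.1 this δ hδ).mono fun y hy => by
            simpa [Real.dist_eq] using hy
        filter_upwards [hP, hci] with y hy hyδ
        let G : ℝ → ℝ := fun t => g (x + ∑ j ∈ J, c j y • b j + t • b i) - t * g' i x
        have hG : ∀ t, HasDerivAt G
            (g' i (x + ∑ j ∈ J, c j y • b j + t • b i) - g' i x) t := fun t =>
          (hasDerivAt_line (h i) _ t).sub (by simpa using (hasDerivAt_id t).mul_const (g' i x))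
        have hb := (convex_uIcc (0 : ℝ) (c i y)).norm_image_sub_le_of_norm_hasDerivWithin_le
          (f := G) (C := ε) (fun t _ => (hG t).hasDerivWithinAt)
          (fun t ht => by
            refine (hPQ hy (hQ ?_)).le
            rw [dist_zero_right, Real.norm_eq_abs]
            refine lt_of_le_of_lt ?_ hyδ
            simpa using Set.abs_sub_left_of_mem_uIcc ht)
          Set.left_mem_uIcc Set.right_mem_uIcc
        simp only [G, zero_smul, add_zero, zero_mul, sub_zero] at hb
        rwa [sub_right_comm] at hb
      refine (step.add ih).congr_left fun y => ?_
      rw [Finset.sum_insert hi, Finset.sum_insert hi,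
        show x + (c i y • b i + ∑ j ∈ J, c j y • b j)
          = x + ∑ j ∈ J, c j y • b j + c i y • b i by abel]
      ring
  rw [hasFDerivAt_iff_isLittleO_nhds_zero]
  refine (main Finset.univ).congr_left fun y => ?_
  have hy : ∑ i, c i y • b i = y := by simp [c, b.sum_repr]
  rw [hy]
  congr 1
  simp [c, mul_comm]

/-- A function with `C^s` derivatives in the directions of a basis is of class `C^{s+1}`. -/
theorem contDiff_succ_of_hasDerivAt_basis [FiniteDimensional ℝ E] {ι : Type*} [Fintype ι]
    (b : Module.Basis ι ℝ E) {s : ℕ} {g : E → ℝ} {g' : ι → E → ℝ}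
    (hg' : ∀ i, ContDiff ℝ s (g' i))
    (h : ∀ i x, HasDerivAt (fun t : ℝ => g (x + t • b i)) (g' i x) 0) :
    ContDiff ℝ (s + 1 : ℕ) g := by
  push_cast
  rw [contDiff_succ_iff_hasFDerivAt]
  refine ⟨_, ?_, hasFDerivAt_of_hasDerivAt_basis b (fun i => (hg' i).continuous) h⟩
  exact ContDiff.sum fun i _ => (hg' i).smul contDiff_const

theorem contDiff_dirAverage [FiniteDimensional ℝ E] (v : E) {s : ℕ} {g : E → ℝ}
    (hg : ContDiff ℝ s g) : ContDiff ℝ s (dirAverage v g) := by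
  induction s generalizing g with
  | zero =>
    rw [Nat.cast_zero, contDiff_zero] at *
    exact continuous_dirAverage hg v
  | succ s ih =>
    push_cast at hg
    obtain ⟨g', hg', hd⟩ := contDiff_succ_iff_hasFDerivAt.1 hg
    let b := Module.finBasis ℝ E
    have hg'b : ∀ i, ContDiff ℝ s fun x => g' x (b i) := fun i => hg'.clm_apply contDiff_const
    refine contDiff_succ_of_hasDerivAt_basis b (fun i => ih (hg'b i)) fun i x => ?_
    refine hasDerivAt_dirAverage hg.continuous (hg'b i).continuous (fun y => ?_) v x
    exact (hd y).hasLineDerivAt (b i)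

/-- The successive averages of `g` in the directions of the list `L`. -/
noncomputable def listAverage (L : List E) (g : E → ℝ) : E → ℝ :=
  L.foldr dirAverage g

theorem uniformContinuous_listAverage {g : E → ℝ} (hg : UniformContinuous g) (L : List E) :
    UniformContinuous (listAverage L g) := by
  induction L with
  | nil => exact hg
  | cons v L ih => exact uniformContinuous_dirAverage ih v

theorem contDiff_listAverage [FiniteDimensional ℝ E] {s : ℕ} {g : E → ℝ} (hg : ContDiff ℝ s g)
    (L : List E) : ContDiff ℝ s (listAverage L g) := by
  induction L with
  | nil => exact hg
  | cons v L ih => exact contDiff_dirAverage v ih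

/-- Averaging in the directions of a list produces derivatives in each of them, and these are as
smooth as the given function. -/
theorem exists_hasDerivAt_listAverage [FiniteDimensional ℝ E] {s : ℕ} {g : E → ℝ}
    (hg : ContDiff ℝ s g) (L : List E) {v : E} (hv : v ∈ L) :
    ∃ g' : E → ℝ, ContDiff ℝ s g' ∧
      ∀ x, HasDerivAt (fun t : ℝ => listAverage L g (x + t • v)) (g' x) 0 := by
  induction L with
  | nil => simp at hv
  | cons w L ih =>
    have hL := contDiff_listAverage hg L
    by_cases hvw : v = w
    · subst hvw
      exact ⟨fun x => listAverage L g x - listAverage L g (x - v),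
        hL.sub (hL.comp (contDiff_id.sub contDiff_const)),
        hasDerivAt_dirAverage_self hL.continuous v⟩
    · obtain ⟨g', hg', hd⟩ := ih (by simpa [hvw] using hv)
      exact ⟨dirAverage w g', contDiff_dirAverage w hg',
        hasDerivAt_dirAverage hL.continuous hg'.continuous hd w⟩

/-- Averaging in the directions of a basis raises the smoothness by one order. -/
theorem contDiff_succ_listAverage [FiniteDimensional ℝ E] {ι : Type*} [Fintype ι]
    (b : Module.Basis ι ℝ E) {s : ℕ} {g : E → ℝ} (hg : ContDiff ℝ s g) (L : List E)
    (hL : ∀ i, b i ∈ L) : ContDiff ℝ (s + 1 : ℕ) (listAverage L g) := by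
  choose g' hg' hd using fun i => exists_hasDerivAt_listAverage hg L (hL i)
  exact contDiff_succ_of_hasDerivAt_basis b hg' hd

end Averages

/-! ### Masks and their symbols -/

section Symbols

variable {d : ℕ}

/-- The monomial `z ↦ z^α`, as a character of the torus `(ℂ ∖ {0})^d`. -/
noncomputable def monomialHom (α : Fin d → ℤ) : (Fin d → ℂˣ) →* ℂ where
  toFun z := ∏ i, (z i : ℂ) ^ (α i)
  map_one' := by simp
  map_mul' z w := by simp [mul_zpow, Finset.prod_mul_distrib]

theorem monomialHom_apply (α : Fin d → ℤ) (z : Fin d → ℂˣ) :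
    monomialHom α z = ∏ i, (z i : ℂ) ^ (α i) := rfl

theorem monomialHom_add (α β : Fin d → ℤ) (z : Fin d → ℂˣ) :
    monomialHom (α + β) z = monomialHom α z * monomialHom β z := by
  simp [monomialHom_apply, zpow_add₀, Finset.prod_mul_distrib]

theorem monomialHom_injective : Function.Injective (monomialHom (d := d)) := by
  intro α β h
  ext i
  have h1 := DFunLike.congr_fun h
    (Function.update (1 : Fin d → ℂˣ) i (Units.mk0 (2 : ℂ) two_ne_zero))
  have hval : ∀ γ : Fin d → ℤ,
      monomialHom γ (Function.update (1 : Fin d → ℂˣ) i (Units.mk0 (2 : ℂ) two_ne_zero))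
        = 2 ^ γ i := by
    intro γ
    rw [monomialHom_apply, Finset.prod_eq_single i]
    · simp
    · intro j _ hj; simp [hj]
    · simp
  rw [hval, hval] at h1
  have h2 : (2 : ℝ) ^ α i = 2 ^ β i := by
    apply Complex.ofReal_injective
    push_cast
    exact h1
  exact zpow_right_injective₀ two_pos (by norm_num) h2

/-- A mask is determined by its symbol, because distinct characters are linearly independent. -/
theorem symbol_injective : Function.Injective (symbol (d := d)) := by
  have hli : LinearIndependent ℂ fun α : Fin d → ℤ => (monomialHom α : (Fin d → ℂˣ) → ℂ) :=
    (linearIndependent_monoidHom (Fin d → ℂˣ) ℂ).comp monomialHom monomialHom_injective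
  have hsymb : ∀ a : Mask d, symbol a = Finsupp.linearCombination ℂ
      (fun α : Fin d → ℤ => (monomialHom α : (Fin d → ℂˣ) → ℂ))
      (a.mapRange Complex.ofReal Complex.ofReal_zero) := by
    intro a
    funext z
    rw [Finsupp.linearCombination_apply, Finsupp.sum_mapRange_index (by simp), Finsupp.sum,
      Finset.sum_apply]
    rfl
  intro a b hab
  rw [hsymb, hsymb] at hab
  exact Finsupp.mapRange_injective _ Complex.ofReal_zero Complex.ofReal_injective (hli hab)

/-- The real vector with natural coordinates `v`. -/
def realDir (v : Fin d → ℕ) : Fin d → ℝ := fun i => v i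

/-- The lattice vector with natural coordinates `v`. -/
def intDir (v : Fin d → ℕ) : Fin d → ℤ := fun i => v i

/-- The mask with symbol `a(z) (1 + z^v) / 2`. -/
noncomputable def smoothMask (v : Fin d → ℕ) (a : Mask d) : Mask d :=
  (1 / 2 : ℝ) • (a + a.equivMapDomain (Equiv.addRight (intDir v)))

theorem smoothMask_apply (v : Fin d → ℕ) (a : Mask d) (α : Fin d → ℤ) :
    smoothMask v a α = (a α + a (α - intDir v)) / 2 := by
  simp [smoothMask, Finsupp.equivMapDomain_apply, sub_eq_add_neg]
  ring

theorem symbol_add (a b : Mask d) (z : Fin d → ℂˣ) :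
    symbol (a + b) z = symbol a z + symbol b z :=
  Finsupp.sum_add_index' (by simp) (by intros; push_cast; ring)

theorem symbol_smul (t : ℝ) (a : Mask d) (z : Fin d → ℂˣ) :
    symbol (t • a) z = t * symbol a z := by
  rw [symbol, Finsupp.sum_smul_index' (by simp), symbol, Finsupp.mul_sum]
  simp [mul_assoc]

theorem symbol_smoothMask (v : Fin d → ℕ) (a : Mask d) (z : Fin d → ℂˣ) :
    symbol (smoothMask v a) z = symbol a z * dirFactor v z := by
  have h : symbol (a.equivMapDomain (Equiv.addRight (intDir v))) z
      = symbol a z * ∏ i, (z i : ℂ) ^ (v i) := by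
    rw [symbol, Finsupp.equivMapDomain_eq_mapDomain, Finsupp.sum_mapDomain_index (by simp)
      (by intros; push_cast; ring), symbol, Finsupp.sum_mul]
    refine Finsupp.sum_congr fun α _ => ?_
    have := monomialHom_add α (intDir v) z
    simp only [monomialHom_apply] at this
    rw [Equiv.coe_addRight, this, mul_assoc]
    simp [intDir]
  rw [smoothMask, symbol_smul, symbol_add, h, dirFactor]
  push_cast
  ring

/-- The mask with symbol `a(z) ∏_{v ∈ L} (1 + z^v) / 2`. -/
noncomputable def listMask (L : List (Fin d → ℕ)) (a : Mask d) : Mask d :=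
  L.foldr smoothMask a

theorem symbol_listMask (L : List (Fin d → ℕ)) (a : Mask d) (z : Fin d → ℂˣ) :
    symbol (listMask L a) z = symbol a z * (L.map fun v => dirFactor v z).prod := by
  induction L with
  | nil => simp [listMask]
  | cons v L ih =>
    rw [listMask, List.foldr_cons, ← listMask, symbol_smoothMask, ih, List.map_cons,
      List.prod_cons]
    ring

end Symbols

/-! ### The subdivision operator -/

section Operator

variable {d : ℕ}

theorem finite_subdiv_support (a : Mask d) (α : Fin d → ℤ) :
    {β : Fin d → ℤ | a (α - 2 • β) ≠ 0}.Finite := by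
  have hinj : Function.Injective fun β : Fin d → ℤ => α - 2 • β := by
    intro β γ h
    ext i
    have := congrFun h i
    simpa using this
  refine (a.support.finite_toSet.preimage hinj.injOn).subset fun β hβ => ?_
  simpa using hβ

theorem subdiv_eq_sum (a : Mask d) (f : (Fin d → ℤ) → ℝ) (α : Fin d → ℤ) :
    subdiv a f α = ∑ β ∈ (finite_subdiv_support a α).toFinset, a (α - 2 • β) * f β := by
  refine finsum_eq_sum_of_support_subset _ fun β hβ => ?_
  simpa using left_ne_zero_of_mul hβ

/-- The subdivision operator as a linear map on all sequences. -/
noncomputable def subdivLin (a : Mask d) : ((Fin d → ℤ) → ℝ) →ₗ[ℝ] ((Fin d → ℤ) → ℝ) where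
  toFun := subdiv a
  map_add' f g := by
    funext α
    simp [subdiv_eq_sum, mul_add, Finset.sum_add_distrib]
  map_smul' t f := by
    funext α
    simp only [subdiv_eq_sum, Pi.smul_apply, smul_eq_mul, Finset.mul_sum, RingHom.id_apply]
    exact Finset.sum_congr rfl fun _ _ => by ring

theorem refinedData_const (a : Mask d) (f : (Fin d → ℤ) → ℝ) (k : ℕ) :
    refinedData (fun _ => a) f k = (subdivLin a ^ k) f := by
  induction k with
  | zero => rfl
  | succ k ih => rw [pow_succ', Module.End.mul_apply, ← ih]; rfl

theorem subdivLin_translate (a : Mask d) (f : (Fin d → ℤ) → ℝ) (v α : Fin d → ℤ) :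
    subdivLin a (fun β => f (β - v)) α = subdivLin a f (α - 2 • v) := by
  change (∑ᶠ β, a (α - 2 • β) * f (β - v)) = ∑ᶠ β, a (α - 2 • v - 2 • β) * f β
  rw [← finsum_comp_equiv (Equiv.addRight v)]
  refine finsum_congr fun β => ?_
  rw [Equiv.coe_addRight, add_sub_cancel_right, smul_add, sub_add_eq_sub_sub_swap]

theorem subdivLin_pow_translate (a : Mask d) (f : (Fin d → ℤ) → ℝ) (k : ℕ) (v α : Fin d → ℤ) :
    (subdivLin a ^ k) (fun β => f (β - v)) α = (subdivLin a ^ k) f (α - 2 ^ k • v) := by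
  induction k generalizing α with
  | zero => simp
  | succ k ih =>
    rw [pow_succ', Module.End.mul_apply, Module.End.mul_apply,
      show (subdivLin a ^ k) (fun β => f (β - v))
        = fun β => (subdivLin a ^ k) f (β - 2 ^ k • v) from funext fun β => ih β,
      subdivLin_translate, smul_smul, pow_succ']

theorem subdivLin_smoothMask (v : Fin d → ℕ) (a : Mask d) (f : (Fin d → ℤ) → ℝ)
    (α : Fin d → ℤ) :
    subdivLin (smoothMask v a) f α = (subdivLin a f α + subdivLin a f (α - intDir v)) / 2 := by
  change (∑ᶠ β, smoothMask v a (α - 2 • β) * f β)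
    = ((∑ᶠ β, a (α - 2 • β) * f β) + ∑ᶠ β, a (α - intDir v - 2 • β) * f β) / 2
  have hfin : ∀ α', (Function.support fun β => a (α' - 2 • β) * f β).Finite := fun α' =>
    (finite_subdiv_support a α').subset fun β hβ => left_ne_zero_of_mul hβ
  rw [← finsum_add_distrib (hfin _) (hfin _), div_eq_mul_inv, finsum_mul]
  refine finsum_congr fun β => ?_
  rw [smoothMask_apply, sub_right_comm]
  ring

theorem sum_range_two_mul {M : Type*} [AddCommMonoid M] (p : ℕ → M) (n : ℕ) :
    ∑ l ∈ Finset.range (2 * n), p l = ∑ l ∈ Finset.range n, (p (2 * l) + p (2 * l + 1)) := by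
  induction n with
  | zero => simp
  | succ n ih =>
    rw [mul_add, mul_one, Finset.sum_range_succ, Finset.sum_range_succ, ih,
      Finset.sum_range_succ, add_assoc]

/-- The factor `(1 + z^v) / 2` in the symbol turns the refined data of level `k` into their
average over `2^k` consecutive points in direction `v`; on symbols this is
`∏_{j < k} (1 + z^{2^j v}) = ∑_{l < 2^k} z^{l v}`. -/
theorem subdivLin_pow_smoothMask (v : Fin d → ℕ) (a : Mask d) (f : (Fin d → ℤ) → ℝ) (k : ℕ)
    (α : Fin d → ℤ) :
    (subdivLin (smoothMask v a) ^ k) f α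
      = (∑ l ∈ Finset.range (2 ^ k), (subdivLin a ^ k) f (α - l • intDir v)) / 2 ^ k := by
  induction k generalizing α with
  | zero => simp
  | succ k ih =>
    set H := (subdivLin a ^ k) f with hH
    have hF : (subdivLin (smoothMask v a) ^ k) f
        = (2 ^ k : ℝ)⁻¹ • ∑ l ∈ Finset.range (2 ^ k), fun β => H (β - l • intDir v) := by
      funext β
      rw [ih]
      simp [Finset.sum_apply, div_eq_inv_mul]
    have hS : ∀ α', subdivLin a ((subdivLin (smoothMask v a) ^ k) f) α'
        = (2 ^ k : ℝ)⁻¹ * ∑ l ∈ Finset.range (2 ^ k),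
          subdivLin a H (α' - (2 * l) • intDir v) := by
      intro α'
      rw [hF, map_smul, map_sum, Pi.smul_apply, Finset.sum_apply, smul_eq_mul]
      simp_rw [subdivLin_translate, smul_smul]
    rw [pow_succ' (subdivLin _), Module.End.mul_apply, subdivLin_smoothMask, hS, hS,
      pow_succ' (subdivLin a), Module.End.mul_apply, ← hH, pow_succ' (2 : ℕ) k, sum_range_two_mul,
      Finset.sum_add_distrib]
    have hodd : ∀ l : ℕ, α - intDir v - (2 * l) • intDir v = α - (2 * l + 1) • intDir v := by
      intro l
      rw [add_smul, one_smul, sub_sub, add_comm]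
    simp_rw [hodd]
    field_simp
    ring

/-- Level `k` data at `α` depend only on the initial data near `2^{-k} α`. -/
theorem subdivLin_pow_congr {a : Mask d} {R : ℝ} (hR : ∀ α, a α ≠ 0 → ‖α‖ ≤ R)
    {f f' : (Fin d → ℤ) → ℝ} {k : ℕ} {α : Fin d → ℤ}
    (h : ∀ γ : Fin d → ℤ, ‖α - 2 ^ k • γ‖ ≤ R * (2 ^ k - 1) → f γ = f' γ) :
    (subdivLin a ^ k) f α = (subdivLin a ^ k) f' α := by
  induction k generalizing α with
  | zero => simpa using h α (by simp)
  | succ k ih =>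
    rw [pow_succ', Module.End.mul_apply, Module.End.mul_apply]
    refine finsum_congr fun β => ?_
    by_cases hβ : a (α - 2 • β) = 0
    · rw [hβ, zero_mul, zero_mul]
    rw [ih fun γ hγ => h γ ?_]
    calc ‖α - 2 ^ (k + 1) • γ‖ = ‖(α - 2 • β) + 2 • (β - 2 ^ k • γ)‖ := by
          congr 1
          rw [smul_sub, smul_smul, ← pow_succ']
          abel
      _ ≤ R + 2 * (R * (2 ^ k - 1)) := by
          refine (norm_add_le _ _).trans (add_le_add (hR _ hβ) ?_)
          refine (norm_nsmul_le (n := 2)).trans ?_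
          push_cast
          linarith
      _ = R * (2 ^ (k + 1) - 1) := by ring

end Operator

/-! ### Limit functions of a convergent scheme -/

section Limits

variable {d : ℕ}

/-- The point `2^{-k} α` of the grid of level `k`. -/
noncomputable def gridPoint (k : ℕ) (α : Fin d → ℤ) : Fin d → ℝ := fun i => (α i : ℝ) / 2 ^ k

/-- The lattice point below `x`. -/
noncomputable def floorPoint (x : Fin d → ℝ) : Fin d → ℤ := fun i => ⌊x i⌋

theorem norm_gridPoint (k : ℕ) (α : Fin d → ℤ) : ‖gridPoint k α‖ = ‖α‖ / 2 ^ k := by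
  have h0 : gridPoint 0 α = fun i => (α i : ℝ) := by funext i; simp [gridPoint]
  have h1 : gridPoint k α = (2 ^ k : ℝ)⁻¹ • gridPoint 0 α := by
    funext i; simp [gridPoint, div_eq_inv_mul]
  have h2 : ‖gridPoint 0 α‖ = ‖α‖ := by
    rw [h0]
    refine le_antisymm ((pi_norm_le_iff_of_nonneg (norm_nonneg _)).2 fun i => ?_)
      ((pi_norm_le_iff_of_nonneg (norm_nonneg _)).2 fun i => ?_)
    · rw [Int.norm_cast_real]
      exact norm_le_pi_norm α i
    · rw [← Int.norm_cast_real]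
      exact norm_le_pi_norm (fun i => (α i : ℝ)) i
  rw [h1, norm_smul, h2, norm_inv, norm_pow, Real.norm_ofNat, div_eq_inv_mul]

theorem gridPoint_sub (k : ℕ) (α β : Fin d → ℤ) :
    gridPoint k (α - β) = gridPoint k α - gridPoint k β := by
  funext i; simp [gridPoint, sub_div]

theorem gridPoint_add (k : ℕ) (α β : Fin d → ℤ) :
    gridPoint k (α + β) = gridPoint k α + gridPoint k β := by
  funext i; simp [gridPoint, add_div]

theorem gridPoint_two_pow_smul (k : ℕ) (α : Fin d → ℤ) :
    gridPoint k (2 ^ k • α) = gridPoint 0 α := by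
  funext i; simp [gridPoint]

theorem gridPoint_smul_intDir (k l : ℕ) (v : Fin d → ℕ) :
    gridPoint k (l • intDir v) = ((l : ℝ) / (2 ^ k : ℕ)) • realDir v := by
  funext i; simp [gridPoint, intDir, realDir]; ring

theorem norm_sub_gridPoint_floorPoint_le (x : Fin d → ℝ) :
    ‖x - gridPoint 0 (floorPoint x)‖ ≤ 1 := by
  refine (pi_norm_le_iff_of_nonneg zero_le_one).2 fun i => ?_
  simp only [gridPoint, floorPoint, Pi.sub_apply, pow_zero, div_one, Real.norm_eq_abs]
  rw [abs_le]
  constructor <;> linarith [Int.floor_le (x i), Int.lt_floor_add_one (x i)]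

theorem tendsto_inv_two_pow : Tendsto (fun k : ℕ => (1 : ℝ) / 2 ^ k) atTop (𝓝 0) := by
  simpa using tendsto_pow_atTop_nhds_zero_of_lt_one (r := (1 / 2 : ℝ)) (by norm_num) (by norm_num)

theorem tendsto_gridPoint_const (β : Fin d → ℤ) :
    Tendsto (fun k => gridPoint k β) atTop (𝓝 0) := by
  rw [tendsto_zero_iff_norm_tendsto_zero]
  simp_rw [norm_gridPoint]
  simpa [div_eq_mul_inv] using tendsto_inv_two_pow.const_mul ‖β‖

theorem tendsto_gridPoint_floorPoint (x : Fin d → ℝ) :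
    Tendsto (fun k => gridPoint k (floorPoint ((2 ^ k : ℝ) • x))) atTop (𝓝 x) := by
  rw [tendsto_iff_norm_sub_tendsto_zero]
  refine squeeze_zero (fun _ => norm_nonneg _) (fun k => ?_) tendsto_inv_two_pow
  have h : gridPoint k (floorPoint ((2 ^ k : ℝ) • x)) - x
      = -((2 ^ k : ℝ)⁻¹ • ((2 ^ k : ℝ) • x - gridPoint 0 (floorPoint ((2 ^ k : ℝ) • x)))) := by
    funext i; simp [gridPoint]; field_simp; ring
  rw [h, norm_neg, norm_smul, norm_inv, norm_pow, Real.norm_ofNat, one_div]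
  exact mul_le_of_le_one_right (by positivity) (norm_sub_gridPoint_floorPoint_le _)

theorem isLimit_const_iff {a : Mask d} {f : (Fin d → ℤ) → ℝ} {g : (Fin d → ℝ) → ℝ} :
    IsLimit (fun _ => a) f g ↔ ∀ ε > 0, ∃ K : ℕ, ∀ k, K ≤ k → ∀ α,
      |g (gridPoint k α) - (subdivLin a ^ k) f α| < ε := by
  simp only [IsLimit, Metric.tendstoUniformly_iff, eventually_atTop, refinedData_const,
    dist_zero_left, Real.norm_eq_abs]
  refine forall₂_congr fun ε hε => ⟨?_, ?_⟩
  · rintro ⟨K, hK⟩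
    refine ⟨K + 1, fun k hk α => ?_⟩
    obtain ⟨n, rfl⟩ : ∃ n, k = n + 1 := ⟨k - 1, by omega⟩
    exact hK n (by omega) α
  · rintro ⟨K, hK⟩
    exact ⟨K, fun k hk α => hK (k + 1) (by omega) α⟩

theorem IsLimit.tendsto {a : Mask d} {f : (Fin d → ℤ) → ℝ} {g : (Fin d → ℝ) → ℝ}
    (h : IsLimit (fun _ => a) f g) (hg : Continuous g) {α : ℕ → Fin d → ℤ} {x : Fin d → ℝ}
    (hα : Tendsto (fun k => gridPoint k (α k)) atTop (𝓝 x)) :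
    Tendsto (fun k => (subdivLin a ^ k) f (α k)) atTop (𝓝 (g x)) := by
  have h1 : Tendsto (fun k => g (gridPoint k (α k)) - (subdivLin a ^ k) f (α k)) atTop (𝓝 0) := by
    rw [Metric.tendsto_atTop]
    intro ε hε
    obtain ⟨K, hK⟩ := isLimit_const_iff.1 h ε hε
    exact ⟨K, fun k hk => by simpa [Real.dist_eq] using hK k hk (α k)⟩
  simpa using ((hg.tendsto x).comp hα).sub h1

/-- The sum rule `∑_β a(α - 2β) = 1`: a convergent subdivision operator reproduces constants. It
follows by letting the level tend to infinity in the refinement relation at points that approach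
a point where some limit function does not vanish. -/
theorem subdivLin_one_of_convergent {a : Mask d} (h : StationaryConvergesTo 0 a) :
    subdivLin a (fun _ => 1) = fun _ => 1 := by
  obtain ⟨-, f, -, -, g, hg, hlim, hne⟩ := h
  obtain ⟨x, hx⟩ := Function.ne_iff.1 hne
  have hgc := hg.continuous
  funext α
  let γ : ℕ → Fin d → ℤ := fun k => floorPoint ((2 ^ k : ℝ) • x)
  have hγ : Tendsto (fun k => gridPoint k (γ k)) atTop (𝓝 x) := tendsto_gridPoint_floorPoint x
  have hfine : ∀ β, Tendsto (fun k => gridPoint k (β + γ k)) atTop (𝓝 x) := by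
    intro β
    simp_rw [gridPoint_add]
    simpa using (tendsto_gridPoint_const β).add hγ
  have hcoarse : Tendsto (fun k => gridPoint (k + 1) (α + 2 • γ k)) atTop (𝓝 x) := by
    have h2 : ∀ k, gridPoint (k + 1) (α + 2 • γ k)
        = gridPoint (k + 1) α + gridPoint k (γ k) := by
      intro k
      rw [gridPoint_add]
      congr 1
      funext i
      simp only [gridPoint, Pi.smul_apply, nsmul_eq_mul, pow_succ]
      push_cast
      field_simp
    simp_rw [h2]
    simpa using ((tendsto_gridPoint_const α).comp (tendsto_add_atTop_nat 1)).add hγ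
  -- The refinement relation at level `k`, with the summation index shifted by `γ k`.
  have hrel : ∀ k, (subdivLin a ^ (k + 1)) f (α + 2 • γ k)
      = ∑ β ∈ (finite_subdiv_support a α).toFinset,
        a (α - 2 • β) * (subdivLin a ^ k) f (β + γ k) := by
    intro k
    have ht := subdivLin_translate a (fun β => (subdivLin a ^ k) f (β + γ k)) (γ k) (α + 2 • γ k)
    simp only [sub_add_cancel, add_sub_cancel_right] at ht
    rw [pow_succ', Module.End.mul_apply]
    exact ht.trans (subdiv_eq_sum _ _ _)
  have hlim1 : Tendsto (fun k => (subdivLin a ^ (k + 1)) f (α + 2 • γ k)) atTop (𝓝 (g x)) := by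
    have hα : Tendsto (fun k => gridPoint k (α + 2 • γ (k - 1))) atTop (𝓝 x) :=
      (tendsto_add_atTop_iff_nat 1).1 (by simpa using hcoarse)
    simpa [Function.comp_def] using (hlim.tendsto hgc hα).comp (tendsto_add_atTop_nat 1)
  have hlim2 := tendsto_finsetSum (finite_subdiv_support a α).toFinset
    fun β _ => (hlim.tendsto hgc (hfine β)).const_mul (a (α - 2 • β))
  have heq := tendsto_nhds_unique hlim1 (hlim2.congr fun k => (hrel k).symm)
  rw [← Finset.sum_mul] at heq
  change subdiv a (fun _ => 1) α = 1
  rw [subdiv_eq_sum]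
  simp only [mul_one]
  exact mul_right_cancel₀ hx (by rw [← heq]; simp)

theorem exists_norm_bound (a : Mask d) : ∃ R : ℝ, 0 ≤ R ∧ ∀ α, a α ≠ 0 → ‖α‖ ≤ R := by
  refine ⟨∑ α ∈ a.support, ‖α‖, Finset.sum_nonneg fun _ _ => norm_nonneg _, fun α hα => ?_⟩
  exact Finset.single_le_sum (f := fun α => ‖α‖) (fun _ _ => norm_nonneg _)
    (Finsupp.mem_support_iff.2 hα)

/-- The refined data that start from the unit impulse live on `‖α‖ ≤ 2^k R`. -/
theorem subdivLin_pow_single_eq_zero {a : Mask d} {R : ℝ} (hR0 : 0 ≤ R)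
    (hR : ∀ α, a α ≠ 0 → ‖α‖ ≤ R) {k : ℕ} {α : Fin d → ℤ} (hα : R < ‖gridPoint k α‖) :
    (subdivLin a ^ k) (Pi.single 0 1 : (Fin d → ℤ) → ℝ) α = 0 := by
  rw [norm_gridPoint, lt_div_iff₀ (by positivity)] at hα
  rw [subdivLin_pow_congr hR (f' := 0) fun γ hγ => ?_, map_zero, Pi.zero_apply]
  refine Pi.single_eq_of_ne (fun h0 => ?_) _
  rw [h0, smul_zero, sub_zero] at hγ
  linarith

/-- The limit function of the unit impulse vanishes outside a ball. -/
theorem IsLimit.eq_zero_of_lt_norm {a : Mask d} {R : ℝ} (hR0 : 0 ≤ R)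
    (hR : ∀ α, a α ≠ 0 → ‖α‖ ≤ R) {φ : (Fin d → ℝ) → ℝ} (hφ : Continuous φ)
    (h : IsLimit (fun _ => a) (Pi.single 0 1) φ) {x : Fin d → ℝ} (hx : R < ‖x‖) : φ x = 0 := by
  have ht := tendsto_gridPoint_floorPoint x
  refine tendsto_nhds_unique (h.tendsto hφ ht) (tendsto_const_nhds.congr' ?_)
  filter_upwards [ht.norm.eventually_const_lt hx] with k hk
  exact (subdivLin_pow_single_eq_zero hR0 hR hk).symm

theorem finite_norm_le (r : ℝ) : {β : Fin d → ℤ | ‖β‖ ≤ r}.Finite := by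
  have := (isCompact_closedBall (0 : Fin d → ℤ) r).finite_of_discrete
  simpa [Metric.closedBall] using this

/-- A compactly supported limit of the unit impulse gives, by superposition of its lattice
translates, uniformly continuous limits for all bounded data. -/
theorem exists_uniformContinuous_isLimit {a : Mask d} (h : StationaryConvergesTo 0 a)
    {f : (Fin d → ℤ) → ℝ} (hf : Memℓp f ∞) :
    ∃ g : (Fin d → ℝ) → ℝ, UniformContinuous g ∧ IsLimit (fun _ => a) f g := by
  obtain ⟨R, hR0, hR⟩ := exists_norm_bound a
  have hδ : Memℓp (Pi.single 0 1 : (Fin d → ℤ) → ℝ) ∞ := by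
    refine memℓp_infty ⟨1, ?_⟩
    rintro _ ⟨β, rfl⟩
    by_cases hβ : β = 0
    · subst hβ; simp
    · simp [hβ]
  obtain ⟨φ, hφ, hlim⟩ := h.1 _ hδ
  have hφc := hφ.continuous
  have hφ0 : ∀ x, R < ‖x‖ → φ x = 0 := fun x => hlim.eq_zero_of_lt_norm hR0 hR hφc
  have hφu : UniformContinuous φ := by
    refine Continuous.uniformContinuous_of_tendsto_cocompact hφc (x := 0) ?_
    refine tendsto_const_nhds.congr' ?_
    filter_upwards [tendsto_norm_cocompact_atTop.eventually_gt_atTop R] with x hx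
    exact (hφ0 x hx).symm
  obtain ⟨C, hC⟩ := memℓp_infty_iff.1 hf
  replace hC : ∀ β, |f β| ≤ C := fun β => hC ⟨β, rfl⟩
  have hC0 : 0 ≤ C := (abs_nonneg _).trans (hC 0)
  let B : Finset (Fin d → ℤ) := (finite_norm_le (d := d) (R + 2)).toFinset
  let c : ℝ := B.card * C + 1
  have hc0 : 0 < c := by positivity
  let g : (Fin d → ℝ) → ℝ := fun x => ∑ᶠ β, f β * φ (x - gridPoint 0 β)
  have hnear : ∀ (x y : Fin d → ℝ) (β : Fin d → ℤ), ‖x - y‖ ≤ 1 → ‖y - gridPoint 0 β‖ ≤ R →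
      β - floorPoint x ∈ B := by
    intro x y β hxy hβ
    have h0 : ‖β - floorPoint x‖ = ‖gridPoint 0 (β - floorPoint x)‖ := by simp [norm_gridPoint]
    simp only [B, Set.Finite.mem_toFinset, Set.mem_ofPred_eq]
    rw [h0, gridPoint_sub]
    calc _ = ‖-(y - gridPoint 0 β) + -(x - y) + (x - gridPoint 0 (floorPoint x))‖ := by
          congr 1; abel
      _ ≤ R + 1 + 1 := by
          refine (norm_add₃_le).trans ?_
          rw [norm_neg, norm_neg]
          gcongr
          exact norm_sub_gridPoint_floorPoint_le x
      _ = R + 2 := by ring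
  have hg : ∀ x y : Fin d → ℝ, ‖x - y‖ ≤ 1 → g y
      = ∑ β ∈ B, f (β + floorPoint x) * φ (y - gridPoint 0 (β + floorPoint x)) := by
    intro x y hxy
    simp only [g]
    rw [← finsum_comp_equiv (Equiv.addRight (floorPoint x))]
    refine finsum_eq_sum_of_support_subset _ fun β hβ => ?_
    have hβ' := right_ne_zero_of_mul hβ
    have := hnear x y _ hxy (not_lt.1 fun hlt => hβ' (hφ0 _ hlt))
    simpa using this
  have hsum : ∀ (γ : Fin d → ℤ) (p q : (Fin d → ℤ) → ℝ) (η : ℝ), (∀ β, |p β - q β| ≤ η) → 0 ≤ η →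
      |∑ β ∈ B, f (β + γ) * p β - ∑ β ∈ B, f (β + γ) * q β| ≤ B.card * C * η := by
    intro γ p q η hpq hη
    rw [← Finset.sum_sub_distrib]
    calc _ ≤ ∑ β ∈ B, |f (β + γ) * p β - f (β + γ) * q β| := Finset.abs_sum_le_sum_abs _ _
      _ ≤ ∑ β ∈ B, C * η := by
          refine Finset.sum_le_sum fun β _ => ?_
          rw [← mul_sub, abs_mul]
          exact mul_le_mul (hC _) (hpq β) (abs_nonneg _) hC0
      _ = B.card * C * η := by simp [mul_assoc]
  have hcη : ∀ ε > 0, B.card * C * (ε / c) < ε := by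
    intro ε hε
    rw [mul_div_assoc', div_lt_iff₀ hc0]
    simp only [c]
    linarith
  refine ⟨g, ?_, isLimit_const_iff.2 fun ε hε => ?_⟩
  · rw [Metric.uniformContinuous_iff]
    intro ε hε
    obtain ⟨η, hη, hφη⟩ := Metric.uniformContinuous_iff.1 hφu (ε / c) (by positivity)
    refine ⟨min η 1, by positivity, fun {x y} hxy => ?_⟩
    rw [Real.dist_eq, hg x x (by simp), hg x y (by
      rw [← dist_eq_norm]; exact (hxy.trans_le (min_le_right _ _)).le)]
    refine (hsum _ _ _ (ε / c) (fun β => ?_) (by positivity)).trans_lt (hcη ε hε)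
    rw [← Real.dist_eq]
    refine (hφη ?_).le
    simpa using hxy.trans_le (min_le_left _ _)
  · obtain ⟨K, hK⟩ := isLimit_const_iff.1 hlim (ε / c) (by positivity)
    refine ⟨K, fun k hk α => ?_⟩
    set γ := floorPoint (gridPoint k α) with hγ
    -- The data can be replaced by finitely many impulses near `2^{-k} α`.
    have hdata : (subdivLin a ^ k) f α = ∑ β ∈ B, f (β + γ)
        * (subdivLin a ^ k) (Pi.single 0 1) (α - 2 ^ k • (β + γ)) := by
      rw [subdivLin_pow_congr hR (f' := ∑ β ∈ B, f (β + γ) •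
        fun η => (Pi.single 0 1 : (Fin d → ℤ) → ℝ) (η - (β + γ))) fun η hη => ?_]
      · rw [map_sum, Finset.sum_apply]
        refine Finset.sum_congr rfl fun β _ => ?_
        rw [map_smul, Pi.smul_apply, subdivLin_pow_translate, smul_eq_mul]
      · have hηB : η - γ ∈ B := by
          refine hnear _ (gridPoint k α) η (by simp) ?_
          rw [← gridPoint_two_pow_smul k, ← gridPoint_sub, norm_gridPoint,
            div_le_iff₀ (by positivity)]
          linarith
        rw [Finset.sum_apply, Finset.sum_eq_single_of_mem _ hηB]
        · simp
        · intro β _ hβ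
          have : η - (β + γ) ≠ 0 := fun h0 => hβ (by rw [sub_eq_zero.1 h0]; abel)
          simp [Pi.single_eq_of_ne this]
    rw [hg (gridPoint k α) (gridPoint k α) (by simp), hdata]
    refine (hsum _ _ _ (ε / c) (fun β => ?_) (by positivity)).trans_lt (hcη ε hε)
    have := (hK k hk (α - 2 ^ k • (β + γ))).le
    rwa [gridPoint_sub, gridPoint_two_pow_smul] at this

end Limits

/-! ### Smoothing factors and limit functions -/

section Smoothing

variable {d : ℕ}

/-- A factor `(1 + z^v) / 2` in the symbol averages the limit functions in direction `v`. -/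
theorem IsLimit.smoothMask {a : Mask d} {f : (Fin d → ℤ) → ℝ} {g : (Fin d → ℝ) → ℝ}
    (h : IsLimit (fun _ => a) f g) (hg : UniformContinuous g) (v : Fin d → ℕ) :
    IsLimit (fun _ => smoothMask v a) f (dirAverage (realDir v) g) := by
  refine isLimit_const_iff.2 fun ε hε => ?_
  obtain ⟨N, hN⟩ := exists_forall_abs_dirAverage_sub_le hg (realDir v) (half_pos hε)
  obtain ⟨K, hK⟩ := isLimit_const_iff.1 h (ε / 2) (half_pos hε)
  refine ⟨max N K, fun k hk α => ?_⟩
  have h1 := hN (2 ^ k) ((le_max_left _ _).trans (hk.trans k.lt_two_pow_self.le)) (by positivity)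
    (gridPoint k α)
  have h2 : |(∑ l ∈ Finset.range (2 ^ k),
      g (gridPoint k α - ((l : ℝ) / (2 ^ k : ℕ)) • realDir v)) / (2 ^ k : ℕ)
      - (subdivLin (Subdivision.smoothMask v a) ^ k) f α| < ε / 2 := by
    rw [subdivLin_pow_smoothMask]
    push_cast
    rw [← sub_div, ← Finset.sum_sub_distrib, abs_div, abs_of_pos (by positivity : (0 : ℝ) < 2 ^ k),
      div_lt_iff₀ (by positivity)]
    calc _ ≤ _ := Finset.abs_sum_le_sum_abs _ _
      _ < ∑ l ∈ Finset.range (2 ^ k), ε / 2 := by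
        refine Finset.sum_lt_sum_of_nonempty (by simp) fun l _ => ?_
        have := hK k ((le_max_right _ _).trans hk) (α - l • intDir v)
        rw [gridPoint_sub, gridPoint_smul_intDir] at this
        exact_mod_cast this
      _ = ε / 2 * 2 ^ k := by simp [mul_comm]
  calc _ ≤ _ := abs_sub_le _ _ _
    _ < ε / 2 + ε / 2 := add_lt_add_of_le_of_lt h1 h2
    _ = ε := add_halves ε

theorem IsLimit.listMask {a : Mask d} {f : (Fin d → ℤ) → ℝ} {g : (Fin d → ℝ) → ℝ}
    (h : IsLimit (fun _ => a) f g) (hg : UniformContinuous g) (L : List (Fin d → ℕ)) :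
    IsLimit (fun _ => listMask L a) f (listAverage (L.map realDir) g) := by
  induction L with
  | nil => exact h
  | cons v L ih => exact ih.smoothMask (uniformContinuous_listAverage hg _) v

theorem subdivLin_listMask_one {a : Mask d} (h : subdivLin a (fun _ => 1) = fun _ => 1)
    (L : List (Fin d → ℕ)) : subdivLin (listMask L a) (fun _ => 1) = fun _ => 1 := by
  induction L with
  | nil => exact h
  | cons v L ih =>
    funext α
    change subdivLin (smoothMask v (listMask L a)) _ α = 1
    rw [subdivLin_smoothMask, ih]
    norm_num

/-- A scheme that reproduces constants and has uniformly continuous `C^s` limit functions for all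
bounded data. Unlike convergence to `C^s` limit functions, this is visibly stable under smoothing:
uniform continuity makes Riemann sums converge uniformly, and the limit function `1` survives every
averaging. -/
structure HasUniformLimits (s : ℕ) (a : Mask d) : Prop where
  subdivLin_one : subdivLin a (fun _ => 1) = fun _ => 1
  exists_isLimit : ∀ f : (Fin d → ℤ) → ℝ, Memℓp f ∞ → ∃ g : (Fin d → ℝ) → ℝ,
    ContDiff ℝ s g ∧ UniformContinuous g ∧ IsLimit (fun _ => a) f g

theorem HasUniformLimits.of_convergent {a : Mask d} (h : StationaryConvergesTo 0 a) :
    HasUniformLimits 0 a := by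
  refine ⟨subdivLin_one_of_convergent h, fun f hf => ?_⟩
  obtain ⟨g, hg, hlim⟩ := exists_uniformContinuous_isLimit h hf
  exact ⟨g, by rw [Nat.cast_zero]; exact contDiff_zero.2 hg.continuous, hg, hlim⟩

theorem HasUniformLimits.stationaryConvergesTo {s : ℕ} {a : Mask d} (h : HasUniformLimits s a) :
    StationaryConvergesTo s a := by
  refine ⟨fun f hf => ?_, fun _ => 1, ?_, ?_,
    fun _ => 1, contDiff_const, ?_, ?_⟩
  · obtain ⟨g, hg, -, hlim⟩ := h.exists_isLimit f hf
    exact ⟨g, hg, hlim⟩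
  · exact memℓp_infty ⟨1, by rintro _ ⟨β, rfl⟩; simp⟩
  · exact fun h0 => one_ne_zero (congrFun h0 0)
  · have hpow : ∀ k, (subdivLin a ^ k) (fun _ => 1) = fun _ => 1 := by
      intro k
      induction k with
      | zero => rfl
      | succ k ih => rw [pow_succ', Module.End.mul_apply, ih, h.subdivLin_one]
    refine isLimit_const_iff.2 fun ε hε => ⟨0, fun k _ α => ?_⟩
    simpa [hpow k] using hε
  · exact fun h0 => one_ne_zero (congrFun h0 0)

theorem HasUniformLimits.mono {s t : ℕ} (hst : s ≤ t) {a : Mask d} (h : HasUniformLimits t a) :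
    HasUniformLimits s a := by
  refine ⟨h.subdivLin_one, fun f hf => ?_⟩
  obtain ⟨g, hg, hu, hlim⟩ := h.exists_isLimit f hf
  exact ⟨g, hg.of_le (by exact_mod_cast hst), hu, hlim⟩

theorem HasUniformLimits.listMask {s : ℕ} {a : Mask d} (h : HasUniformLimits s a)
    (L : List (Fin d → ℕ)) : HasUniformLimits s (listMask L a) := by
  refine ⟨subdivLin_listMask_one h.subdivLin_one L, fun f hf => ?_⟩
  obtain ⟨g, hg, hu, hlim⟩ := h.exists_isLimit f hf
  exact ⟨listAverage (L.map realDir) g, contDiff_listAverage hg _,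
    uniformContinuous_listAverage hu _, hlim.listMask hu L⟩

/-- Smoothing in the directions of a basis gains one order of smoothness. -/
theorem HasUniformLimits.listMask_ofFn {s : ℕ} {a : Mask d} (h : HasUniformLimits s a)
    {V : Fin d → Fin d → ℕ} (hV : IsNatBasis V) :
    HasUniformLimits (s + 1) (Subdivision.listMask (List.ofFn V) a) := by
  refine ⟨subdivLin_listMask_one h.subdivLin_one _, fun f hf => ?_⟩
  obtain ⟨g, hg, hu, hlim⟩ := h.exists_isLimit f hf
  refine ⟨listAverage ((List.ofFn V).map realDir) g, ?_, uniformContinuous_listAverage hu _,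
    hlim.listMask hu _⟩
  have hV' : LinearIndependent ℝ fun j => realDir (V j) := hV
  have hspan := hV'.span_eq_top_of_card_eq_finrank' (by simp)
  refine contDiff_succ_listAverage (Module.Basis.mk hV' hspan.ge) hg _ fun i => ?_
  rw [Module.Basis.mk_apply]
  exact List.mem_map.2 ⟨V i, by simp [List.mem_ofFn], rfl⟩

/-- Masks of the class of index `m` have limit functions that are even of class `C^m`. -/
theorem hasUniformLimits_of_mem_classC {𝒱 : ℕ → Fin d → Fin d → ℕ}
    (h𝒱 : ∀ j : ℕ, 1 ≤ j → IsNatBasis (𝒱 j)) (m : ℕ) {c : Mask d} (hc : c ∈ classC 𝒱 m) :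
    HasUniformLimits m c := by
  induction m generalizing c with
  | zero =>
    obtain ⟨a, D, -, ha, hsymb⟩ := hc
    have hc' : c = listMask D.toList a := symbol_injective <| funext fun z => by
      rw [hsymb, symbol_listMask, collectionFactor, ← Multiset.prod_toList]
      congr 1
      rw [Multiset.prod_toList, ← Multiset.prod_coe, ← Multiset.map_coe, Multiset.coe_toList]
    rw [hc']
    exact (HasUniformLimits.of_convergent ha).listMask _
  | succ m ih =>
    obtain ⟨c', hc', hsymb⟩ := hc
    have hc'' : c = listMask (List.ofFn (𝒱 (m + 1))) c' := symbol_injective <| funext fun z => by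
      rw [hsymb, symbol_listMask, fullFactor, List.map_ofFn, List.prod_ofFn]
      rfl
    rw [hc'']
    exact (ih hc').listMask_ofFn (h𝒱 _ (by omega))

end Smoothing

end Subdivision

theorem proposition3p4 (d : ℕ) (𝒱 : ℕ → Fin d → Fin d → ℕ)
    (h𝒱 : ∀ j : ℕ, 1 ≤ j → Subdivision.IsNatBasis (𝒱 j))
    (m : ℕ) (hm : 1 ≤ m) (c : Subdivision.Mask d) (hc : c ∈ Subdivision.classC 𝒱 m) :
    Subdivision.StationaryConvergesTo (m - 1) c :=
  ((Subdivision.hasUniformLimits_of_mem_classC h𝒱 m hc).mono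
    (Nat.sub_le m 1)).stationaryConvergesTo
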